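/- Let $\mathcal H$ be a finite-dimensional complex Hilbert space; operators on it are identified with complex matrices. A state is a positive semidefinite operator of trace one, $\log$ is the natural logarithm, and $h(\varepsilon) = -\varepsilon\log\varepsilon-(1-\varepsilon)\log(1-\varepsilon)$. For a state $\rho$ and $\sigma\ge 0$ put $D(\rho\|\sigma)=\operatorname{Tr}(\rho\log\rho-\rho\log\sigma)$ if $\ker\sigma\subseteq\ker\rho$ and $D(\rho\|\sigma)=\infty$ otherwise, and $D_{\max}(\rho\|\sigma)=\inf\{\lambda>0 : \rho\le e^{\lambda}\sigma\}$ (Loewner order, $\inf\emptyset=\infty$). For states $\rho_1,\rho_2$ at trace distance $\frac12\|\rho_1-\rho_2\|_1=\varepsilon>0$, let $\rho_1-\rho_2=\varepsilon\rho_+-\varepsilon\rho_-$ be the Jordan–Hahn decomposition, i.e. $\varepsilon\rho_\pm\ge 0$ have mutually orthogonal supports; then $\rho_\pm$ are states. **Theorem.** (1) Let $\varepsilon\in(0,1)$, let $\rho_1,\rho_2$ be states with $\frac12\|\rho_1-\rho_2\|_1=\varepsilon$, and let $\sigma$ be a positive definite state. Then all the relative entropies and max-relative entropies below are finite, $e^{\max\{D_{\max}(\rho_+\|\sigma),\,D_{\max}(\rho_-\|\sigma)\}}>1$,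 and $$|D(\rho_1\|\sigma)-D(\rho_2\|\sigma)|\le \varepsilon\log\bigl(e^{\max\{D_{\max}(\rho_+\|\sigma),\,D_{\max}(\rho_-\|\sigma)\}}-1\bigr)+h(\varepsilon).$$ (2) In particular, let $\varepsilon\in(0,1)$, let $\rho$ be a state and $\sigma$ a positive definite state with $\frac12\|\rho-\sigma\|_1=\varepsilon$, and let $\rho-\sigma=\varepsilon\omega_+-\varepsilon\omega_-$ be the Jordan–Hahn decomposition. Then $D(\rho\|\sigma)$ and $D_{\max}(\omega_+\|\sigma)$ are finite, $e^{D_{\max}(\omega_+\|\sigma)}>1$, and $$D(\rho\|\sigma)\le\varepsilon\log\bigl(e^{D_{\max}(\omega_+\|\sigma)}-1\bigr)+h(\varepsilon).$$ -/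

import Mathlib

open scoped Matrix ComplexOrder

noncomputable section

namespace QuantumEntropy

variable {n : Type*} [Fintype n] [DecidableEq n]

/-- A quantum state (density matrix): a positive semidefinite matrix of unit trace. -/
structure IsState (ρ : Matrix n n ℂ) : Prop where
  posSemidef : ρ.PosSemidef
  trace_eq_one : ρ.trace = 1

/-- The trace norm `‖A‖₁ = Tr √(A* A)`. -/
def traceNorm (A : Matrix n n ℂ) : ℝ :=
  (cfc Real.sqrt (Aᴴ * A)).trace.re

/-- The trace distance `½ ‖A - B‖₁`. -/
def traceDist (A B : Matrix n n ℂ) : ℝ :=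
  (1 / 2) * traceNorm (A - B)

open scoped Classical in
/-- The Umegaki relative entropy: `D(ρ‖σ) = Tr (ρ log ρ - ρ log σ)` if `ker σ ⊆ ker ρ`, and `∞`
otherwise. The logarithm of a matrix is taken through the functional calculus, with `log 0 = 0`. -/
def relEntropy (ρ σ : Matrix n n ℂ) : EReal :=
  if LinearMap.ker σ.mulVecLin ≤ LinearMap.ker ρ.mulVecLin then
    (((ρ * cfc Real.log ρ - ρ * cfc Real.log σ).trace.re : ℝ) : EReal)
  else ⊤

/-- The max-relative entropy `D_max(ρ‖σ) = inf {l > 0 : ρ ≤ e^l σ}` with respect to the Loewner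
order; the infimum of the empty set is `∞`. -/
def maxRelEntropy (ρ σ : Matrix n n ℂ) : EReal :=
  sInf {x : EReal | ∃ l : ℝ, 0 < l ∧ (Real.exp l • σ - ρ).PosSemidef ∧ x = (l : EReal)}

/-- `Δ = P - N` is the Jordan-Hahn decomposition of `Δ`: the matrices `P` and `N` are positive
semidefinite with mutually orthogonal supports (for Hermitian matrices this is `P N = 0`). -/
structure IsJordanHahn (Δ P N : Matrix n n ℂ) : Prop where
  pos : P.PosSemidef
  neg : N.PosSemidef
  orthogonal : P * N = 0
  eq_sub : Δ = P - N

open scoped MatrixOrder in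
/-- Every Hermitian matrix has a Jordan-Hahn decomposition. -/
theorem exists_isJordanHahn {Δ : Matrix n n ℂ} (hΔ : Δ.IsHermitian) :
    ∃ P N : Matrix n n ℂ, IsJordanHahn Δ P N :=
  ⟨Δ⁺, Δ⁻, Matrix.nonneg_iff_posSemidef.mp (CFC.posPart_nonneg Δ),
    Matrix.nonneg_iff_posSemidef.mp (CFC.negPart_nonneg Δ),
    CFC.posPart_mul_negPart Δ, (CFC.posPart_sub_negPart Δ hΔ).symm⟩

end QuantumEntropy

end

/-! Write `P = ε ρ₊`, `N = ε ρ₋` and `f(A) = Tr A log A`. Then `D(ρ₁‖σ) - D(ρ₂‖σ)` equals `f(ρ₁) -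
f(ρ₂) - Tr P log σ + Tr N log σ`, and each piece is bounded with the Jordan-Hahn parts kept.

Entropies (`traceMulLog_sub_le`): the matrix `ρ₁ + N = ρ₂ + P` is split in two ways. Superadditivity
of `f` on the first splitting and almost additivity on the second give `f(ρ₁) - f(ρ₂) ≤ f(P) - f(N)
+ h(ε)`.

Cross terms: let `m = D_max(ρ₊‖σ)` and let `s` be the weight of `σ` on the support of `N`. Operator
monotonicity of the logarithm applied to `P ≤ ε e^l σ` gives `f(P) - Tr P log σ ≤ ε log ε + ε m`,
and `trace_mul_log_le` gives `Tr N log σ - f(N) ≤ -ε log ε + ε log s`. The sum is `ε (m + log s)`.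
Since `σ` has weight at least `e^{-m}` on the support of `P`, which is orthogonal to that of `N`,
one has `s ≤ 1 - e^{-m}`, hence `m + log s ≤ log (e^m - 1)`.

Exchanging the states gives the absolute value; taking `ρ₂ = σ` gives the second claim. -/

namespace QuantumEntropy

variable {n : Type*} [Fintype n] [DecidableEq n]

/-! ### Traces of products of functions of Hermitian matrices -/

/-- The squared moduli of the inner products of the eigenvectors of two Hermitian matrices. -/
noncomputable def overlap {A B : Matrix n n ℂ} (hA : A.IsHermitian) (hB : B.IsHermitian) (i j : n) : ℝ :=
  Complex.normSq ((star (hA.eigenvectorUnitary : Matrix n n ℂ) *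
    (hB.eigenvectorUnitary : Matrix n n ℂ)) i j)

section overlap

variable {A B : Matrix n n ℂ} (hA : A.IsHermitian) (hB : B.IsHermitian)

theorem overlap_nonneg (i j : n) : 0 ≤ overlap hA hB i j := Complex.normSq_nonneg _

/-- Expanding in both eigenbases leaves a doubly stochastic weight, so trace inequalities reduce to
scalar inequalities between pairs of eigenvalues. -/
theorem trace_cfc_mul_cfc (f g : ℝ → ℝ) :
    (cfc f A * cfc g B).trace.re =
      ∑ i, ∑ j, f (hA.eigenvalues i) * g (hB.eigenvalues j) * overlap hA hB i j := by
  rw [hA.cfc_eq, hB.cfc_eq, Matrix.IsHermitian.cfc, Matrix.IsHermitian.cfc,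
    Unitary.conjStarAlgAut_apply, Unitary.conjStarAlgAut_apply]
  set U : Matrix n n ℂ := (hA.eigenvectorUnitary : Matrix n n ℂ) with hU
  set V : Matrix n n ℂ := (hB.eigenvectorUnitary : Matrix n n ℂ) with hV
  set D : n → ℂ := RCLike.ofReal ∘ f ∘ hA.eigenvalues
  set E : n → ℂ := RCLike.ofReal ∘ g ∘ hB.eigenvalues
  have h : (U * Matrix.diagonal D * star U * (V * Matrix.diagonal E * star V)).trace =
      ((Matrix.diagonal D * (star U * V)) * (Matrix.diagonal E * star (star U * V))).trace := by
    rw [star_mul, star_star, Matrix.trace_mul_comm, ← Matrix.mul_assoc, Matrix.mul_assoc _ _ (star U),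
      Matrix.mul_assoc U, ← Matrix.mul_assoc _ U, Matrix.trace_mul_comm]
    simp only [Matrix.mul_assoc]
  rw [h, Matrix.trace, Complex.re_sum]
  refine Finset.sum_congr rfl fun i _ => ?_
  rw [Matrix.diag_apply, Matrix.mul_apply, Complex.re_sum]
  refine Finset.sum_congr rfl fun j _ => ?_
  rw [Matrix.diagonal_mul, Matrix.diagonal_mul, Matrix.star_apply, overlap, Complex.normSq_apply]
  simp only [D, E, Function.comp_apply, Complex.mul_re, Complex.mul_im, ← hU, ← hV,
    RCLike.star_def, Complex.conj_re, Complex.conj_im, Complex.coe_algebraMap,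
    Complex.ofReal_re, Complex.ofReal_im]
  ring

theorem sum_overlap_right (i : n) : ∑ j, overlap hA hB i j = 1 := by
  set W : Matrix n n ℂ := star (hA.eigenvectorUnitary : Matrix n n ℂ) *
    (hB.eigenvectorUnitary : Matrix n n ℂ) with hW
  have h : W * star W = 1 := by
    rw [hW, star_mul, star_star, Matrix.mul_assoc, ← Matrix.mul_assoc (hB.eigenvectorUnitary :
      Matrix n n ℂ), Unitary.mul_star_self_of_mem (SetLike.coe_mem _), Matrix.one_mul,
      Unitary.star_mul_self_of_mem (SetLike.coe_mem _)]
  have h2 := congrArg (fun M : Matrix n n ℂ => (M i i).re) h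
  simp only [Matrix.mul_apply, Matrix.one_apply_eq, Complex.re_sum, Complex.one_re] at h2
  rw [← h2]
  refine Finset.sum_congr rfl fun j _ => ?_
  rw [Matrix.star_apply, overlap, ← hW, Complex.star_def, Complex.mul_conj, Complex.ofReal_re]

theorem overlap_comm (i j : n) : overlap hA hB i j = overlap hB hA j i := by
  rw [overlap, overlap, ← Complex.normSq_conj, ← Complex.star_def, ← Matrix.star_apply, star_mul,
    star_star]

theorem sum_overlap_left (j : n) : ∑ i, overlap hA hB i j = 1 := by
  simp only [overlap_comm hA hB, sum_overlap_right]

theorem trace_mul_cfc (g : ℝ → ℝ) :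
    (A * cfc g B).trace.re =
      ∑ i, ∑ j, hA.eigenvalues i * g (hB.eigenvalues j) * overlap hA hB i j := by
  conv_lhs => rw [← cfc_id ℝ A hA.isSelfAdjoint]
  exact trace_cfc_mul_cfc hA hB id g

theorem trace_cfc_mul (f : ℝ → ℝ) :
    (cfc f A * B).trace.re =
      ∑ i, ∑ j, f (hA.eigenvalues i) * hB.eigenvalues j * overlap hA hB i j := by
  conv_lhs => rw [← cfc_id ℝ B hB.isSelfAdjoint]
  exact trace_cfc_mul_cfc hA hB f id

theorem trace_cfc (f : ℝ → ℝ) : (cfc f A).trace.re = ∑ i, f (hA.eigenvalues i) := by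
  have h := trace_cfc_mul_cfc hA hA f (fun _ => 1)
  rw [cfc_const_one ℝ A hA.isSelfAdjoint, mul_one] at h
  rw [h]
  exact Finset.sum_congr rfl fun i _ => by rw [← Finset.mul_sum, sum_overlap_right]; simp

theorem trace_re_eq : A.trace.re = ∑ i, hA.eigenvalues i := by
  simpa [cfc_id ℝ A hA.isSelfAdjoint] using trace_cfc hA id

end overlap

open scoped MatrixOrder Matrix.Norms.L2Operator in
/-- The logarithm is operator monotone on positive definite matrices. -/
theorem posSemidef_cfc_log_sub {A B : Matrix n n ℂ} (hA : A.PosDef) (hAB : (B - A).PosSemidef) :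
    (cfc Real.log B - cfc Real.log A).PosSemidef :=
  Matrix.le_iff.mp (CFC.log_le_log (Matrix.le_iff.mpr hAB) hA.isStrictlyPositive)

/-- The trace of a product of positive semidefinite matrices is nonnegative. -/
theorem trace_mul_nonneg {A B : Matrix n n ℂ} (hA : A.PosSemidef) (hB : B.PosSemidef) :
    0 ≤ (A * B).trace.re := by
  have h := trace_mul_cfc hA.1 hB.1 id
  rw [cfc_id ℝ B hB.1.isSelfAdjoint] at h
  rw [h]
  exact Finset.sum_nonneg fun i _ => Finset.sum_nonneg fun j _ => mul_nonneg (mul_nonneg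
    (hA.eigenvalues_nonneg i) (hB.eigenvalues_nonneg j)) (overlap_nonneg _ _ _ _)

theorem trace_mul_le_trace_mul {A B C : Matrix n n ℂ} (hA : A.PosSemidef)
    (hBC : (C - B).PosSemidef) : (A * B).trace.re ≤ (A * C).trace.re := by
  have h := trace_mul_nonneg hA hBC
  rw [Matrix.mul_sub, Matrix.trace_sub, Complex.sub_re] at h
  linarith

/-! ### The functional `Tr (A log A)` -/

/-- `Tr (A log A)`, the negative of the von Neumann entropy. -/
noncomputable def traceMulLog (A : Matrix n n ℂ) : ℝ := (A * cfc Real.log A).trace.re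

theorem mul_cfc_self {A : Matrix n n ℂ} (hA : A.IsHermitian) (f : ℝ → ℝ) :
    A * cfc f A = cfc (fun x => x * f x) A := by
  rw [cfc_mul (fun x => x) f A (A.finite_real_spectrum.continuousOn _)
    (A.finite_real_spectrum.continuousOn _), cfc_id' ℝ A hA.isSelfAdjoint]

theorem traceMulLog_eq_sum {A : Matrix n n ℂ} (hA : A.IsHermitian) :
    traceMulLog A = ∑ i, hA.eigenvalues i * Real.log (hA.eigenvalues i) := by
  rw [traceMulLog, mul_cfc_self hA, trace_cfc hA]

theorem cfc_add_smul_one {A : Matrix n n ℂ} (hA : A.IsHermitian) (f : ℝ → ℝ) (δ : ℝ) :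
    cfc f (A + δ • 1) = cfc (fun x => f (x + δ)) A := by
  have h : A + δ • 1 = cfc (fun x => x + δ) A := by
    rw [cfc_add_const δ (fun x => x) A (A.finite_real_spectrum.continuousOn _) hA.isSelfAdjoint,
      cfc_id' ℝ A hA.isSelfAdjoint, Algebra.algebraMap_eq_smul_one]
  rw [h, ← cfc_comp' f (fun x => x + δ) A ((A.finite_real_spectrum.image _).continuousOn _)
    (A.finite_real_spectrum.continuousOn _) hA.isSelfAdjoint]

theorem posDef_add_smul_one {m : Type*} [DecidableEq m] {A : Matrix m m ℂ} (hA : A.PosSemidef) {δ : ℝ} (hδ : 0 < δ) :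
    (A + δ • 1).PosDef :=
  Matrix.PosDef.posSemidef_add hA (Matrix.PosDef.one.smul hδ)

/-- This is `log t ≤ t - 1` at `t = y / x`, multiplied by `x`; it is also the tangent-line
inequality for `x log x`. -/
theorem mul_log_sub_mul_log_le {x y : ℝ} (hx : 0 ≤ x) (hy : 0 < y) :
    x * Real.log y - x * Real.log x ≤ y - x := by
  rcases hx.eq_or_lt with rfl | hx
  · simpa using hy.le
  · have h := Real.log_le_sub_one_of_pos (div_pos hy hx)
    rw [Real.log_div hy.ne' hx.ne'] at h
    have h2 := mul_le_mul_of_nonneg_left h hx.le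
    have h3 : x * (y / x - 1) = y - x := by field_simp
    linarith

/-- **Klein's inequality**. -/
theorem trace_mul_log_sub_le {A B : Matrix n n ℂ} (hA : A.PosSemidef) (hB : B.PosDef) :
    (A * cfc Real.log B).trace.re - traceMulLog A ≤ B.trace.re - A.trace.re := by
  rw [trace_mul_cfc hA.1 hB.1, traceMulLog_eq_sum hA.1, trace_re_eq hA.1, trace_re_eq hB.1]
  have h1 : ∀ f : n → ℝ, ∑ i, f i = ∑ i, ∑ j, f i * overlap hA.1 hB.1 i j := fun f =>
    Finset.sum_congr rfl fun i _ => by rw [← Finset.mul_sum, sum_overlap_right, mul_one]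
  have h2 : ∀ f : n → ℝ, ∑ j, f j = ∑ i, ∑ j, f j * overlap hA.1 hB.1 i j := fun f => by
    rw [Finset.sum_comm]
    exact Finset.sum_congr rfl fun i _ => by rw [← Finset.mul_sum, sum_overlap_left, mul_one]
  rw [h1 hA.1.eigenvalues, h1 (fun i => hA.1.eigenvalues i * Real.log (hA.1.eigenvalues i)),
    h2 hB.1.eigenvalues]
  simp only [← Finset.sum_sub_distrib, ← sub_mul]
  exact Finset.sum_le_sum fun i _ => Finset.sum_le_sum fun j _ => mul_le_mul_of_nonneg_right
    (mul_log_sub_mul_log_le (hA.eigenvalues_nonneg i) (hB.eigenvalues_pos j))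
    (overlap_nonneg _ _ _ _)

/-! ### Support projections -/

/-- The projection onto the span of the eigenvectors with positive eigenvalues. -/
noncomputable def supportProj (A : Matrix n n ℂ) : Matrix n n ℂ :=
  cfc (fun x : ℝ => if 0 < x then 1 else 0) A

section supportProj

variable {A B : Matrix n n ℂ}

theorem isHermitian_supportProj (A : Matrix n n ℂ) : (supportProj A).IsHermitian :=
  cfc_predicate (R := ℝ) (p := IsSelfAdjoint) _ A

theorem supportProj_mul_self (A : Matrix n n ℂ) : supportProj A * supportProj A = supportProj A := by
  rw [supportProj, ← cfc_mul _ _ A (A.finite_real_spectrum.continuousOn _)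
    (A.finite_real_spectrum.continuousOn _)]
  congr 1
  ext x
  simp

theorem posSemidef_of_isHermitian_of_mul_self {m : Type*} [Fintype m] {Q : Matrix m m ℂ} (hQ : Q.IsHermitian)
    (h : Q * Q = Q) : Q.PosSemidef := by
  have := Matrix.posSemidef_conjTranspose_mul_self Q
  rwa [hQ.eq, h] at this

theorem posSemidef_supportProj (A : Matrix n n ℂ) : (supportProj A).PosSemidef :=
  posSemidef_of_isHermitian_of_mul_self (isHermitian_supportProj A) (supportProj_mul_self A)

theorem trace_supportProj_mul (hA : A.IsHermitian) (hB : B.IsHermitian) :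
    (supportProj A * B).trace.re = ∑ i, ∑ j, (if 0 < hA.eigenvalues i then 1 else 0) *
      hB.eigenvalues j * overlap hA hB i j :=
  trace_cfc_mul hA hB _

theorem trace_supportProj_mul_self (hA : A.PosSemidef) :
    (supportProj A * A).trace.re = A.trace.re := by
  rw [Matrix.trace_mul_comm, supportProj, mul_cfc_self hA.1, trace_cfc hA.1, trace_re_eq hA.1]
  refine Finset.sum_congr rfl fun i _ => ?_
  split_ifs with hi
  · rw [mul_one]
  · rw [mul_zero, le_antisymm (not_lt.mp hi) (hA.eigenvalues_nonneg i)]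

theorem trace_supportProj_mul_pos (hA : A.PosSemidef) (hA' : 0 < A.trace.re) (hB : B.PosDef) :
    0 < (supportProj A * B).trace.re := by
  rw [trace_re_eq hA.1] at hA'
  obtain ⟨i, -, hi⟩ := Finset.exists_lt_of_sum_lt (s := Finset.univ) (f := fun _ : n => (0 : ℝ))
    (by simpa using hA')
  rw [trace_supportProj_mul hA.1 hB.1]
  have h0 : ∀ i j, 0 ≤ (if 0 < hA.1.eigenvalues i then 1 else 0) *
      hB.1.eigenvalues j * overlap hA.1 hB.1 i j := fun i j =>
    mul_nonneg (mul_nonneg (by split_ifs <;> norm_num) (hB.eigenvalues_pos j).le)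
      (overlap_nonneg _ _ _ _)
  obtain ⟨j, -, hj⟩ := Finset.exists_lt_of_sum_lt (s := Finset.univ) (f := fun _ : n => (0 : ℝ))
    (g := fun j => overlap hA.1 hB.1 i j) (by rw [sum_overlap_right]; simp)
  refine Finset.sum_pos' (fun i _ => Finset.sum_nonneg fun j _ => h0 i j)
    ⟨i, Finset.mem_univ i, Finset.sum_pos' (fun j _ => h0 i j) ⟨j, Finset.mem_univ j, ?_⟩⟩
  rw [if_pos hi, one_mul]
  exact mul_pos (hB.eigenvalues_pos j) hj

/-- If positive semidefinite matrices are orthogonal, so are their supports. -/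
theorem trace_supportProj_mul_eq_zero (hA : A.PosSemidef) (hB : B.PosSemidef)
    (h : (A * B).trace.re = 0) : (supportProj A * B).trace.re = 0 := by
  have h1 := trace_cfc_mul hA.1 hB.1 id
  rw [cfc_id ℝ A hA.1.isSelfAdjoint, h] at h1
  have h0 : ∀ i j, 0 ≤ hA.1.eigenvalues i * hB.1.eigenvalues j * overlap hA.1 hB.1 i j :=
    fun i j => mul_nonneg (mul_nonneg (hA.eigenvalues_nonneg i) (hB.eigenvalues_nonneg j))
      (overlap_nonneg _ _ _ _)
  rw [trace_supportProj_mul hA.1 hB.1]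
  refine Finset.sum_eq_zero fun i _ => Finset.sum_eq_zero fun j _ => ?_
  have h2 := (Finset.sum_eq_zero_iff_of_nonneg fun i _ => Finset.sum_nonneg fun j _ => h0 i j).mp
    h1.symm i (Finset.mem_univ i)
  have h3 := (Finset.sum_eq_zero_iff_of_nonneg fun j _ => h0 i j).mp h2 j (Finset.mem_univ j)
  split_ifs with hi
  · rw [mul_assoc, mul_eq_zero] at h3
    rw [mul_assoc, h3.resolve_left hi.ne', mul_zero]
  · simp

/-- The supports of orthogonal positive semidefinite matrices add up to at most the identity. -/
theorem posSemidef_one_sub_supportProj_add (hA : A.PosSemidef) (hB : B.PosSemidef)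
    (h : (A * B).trace.re = 0) : (1 - (supportProj A + supportProj B)).PosSemidef := by
  set P := supportProj A with hP
  set R := supportProj B with hR
  have hPh : P.IsHermitian := isHermitian_supportProj A
  have hRh : R.IsHermitian := isHermitian_supportProj B
  have hPP : P * P = P := supportProj_mul_self A
  have hRR : R * R = R := supportProj_mul_self B
  have h1 : (B * P).trace.re = 0 := by
    rw [Matrix.trace_mul_comm]; exact trace_supportProj_mul_eq_zero hA hB h
  have h2 : (R * P).trace.re = 0 :=
    trace_supportProj_mul_eq_zero hB (posSemidef_supportProj A) h1
  -- The trace of `R P` is the squared Hilbert-Schmidt norm of `P R`, so its vanishing forces `P R =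
  -- 0`.
  have h3 : ((P * R)ᴴ * (P * R)).PosSemidef := Matrix.posSemidef_conjTranspose_mul_self _
  have h4 : ((P * R)ᴴ * (P * R)).trace = (R * P).trace := by
    rw [Matrix.conjTranspose_mul, hPh.eq, hRh.eq, Matrix.mul_assoc, ← Matrix.mul_assoc P P, hPP,
      Matrix.trace_mul_comm, Matrix.mul_assoc, hRR, Matrix.trace_mul_comm]
  have h5 : ((P * R)ᴴ * (P * R)).trace = 0 := by
    refine Complex.ext ?_ ?_
    · rw [h4, h2, Complex.zero_re]
    · exact (Complex.nonneg_iff.mp h3.trace_nonneg).2.symm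
  have hPR : P * R = 0 := Matrix.trace_conjTranspose_mul_self_eq_zero_iff.mp h5
  have hRP : R * P = 0 := by
    have := congrArg Matrix.conjTranspose hPR
    rwa [Matrix.conjTranspose_mul, hPh.eq, hRh.eq, Matrix.conjTranspose_zero] at this
  refine posSemidef_of_isHermitian_of_mul_self (Matrix.isHermitian_one.sub (hPh.add hRh)) ?_
  simp only [Matrix.mul_sub, Matrix.sub_mul, Matrix.mul_add, Matrix.add_mul, hPP, hRR, hPR, hRP,
    Matrix.one_mul, Matrix.mul_one]
  abel

/-- For positive semidefinite `A`, the cross entropy with respect to `B` is bounded in terms of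
the weight of `B` on the support of `A`. -/
theorem trace_mul_log_le (hA : A.PosSemidef) (hA' : 0 < A.trace.re) (hB : B.PosDef) :
    (A * cfc Real.log B).trace.re ≤ traceMulLog A - A.trace.re * Real.log A.trace.re +
      A.trace.re * Real.log (supportProj A * B).trace.re := by
  have hp := trace_supportProj_mul_pos hA hA' hB
  set p := (supportProj A * B).trace.re with hpdef
  set x := A.trace.re with hx
  have hc : 0 < p / x := div_pos hp hA'
  -- The scalar Klein inequality is applied to `b` rescaled by `x / p`; with this factor the linear
  -- terms cancel after summation.
  have key : ∀ i j, hA.1.eigenvalues i * Real.log (hB.1.eigenvalues j) -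
      hA.1.eigenvalues i * Real.log (hA.1.eigenvalues i) ≤
      (if 0 < hA.1.eigenvalues i then 1 else 0) * hB.1.eigenvalues j * (p / x)⁻¹ +
        hA.1.eigenvalues i * (Real.log (p / x) - 1) := by
    intro i j
    split_ifs with hi
    · have hb := hB.eigenvalues_pos j
      have h := mul_log_sub_mul_log_le hi.le (mul_pos hb (inv_pos.mpr hc))
      rw [Real.log_mul hb.ne' (inv_pos.mpr hc).ne', Real.log_inv] at h
      linarith
    · have : hA.1.eigenvalues i = 0 := le_antisymm (not_lt.mp hi) (hA.eigenvalues_nonneg i)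
      simp [this]
  have h1 : ∀ f : n → ℝ, ∑ i, f i = ∑ i, ∑ j, f i * overlap hA.1 hB.1 i j := fun f =>
    Finset.sum_congr rfl fun i _ => by rw [← Finset.mul_sum, sum_overlap_right, mul_one]
  have main : (A * cfc Real.log B).trace.re - traceMulLog A ≤
      p * (p / x)⁻¹ + x * (Real.log (p / x) - 1) := by
    have ex : x = ∑ i, ∑ j, hA.1.eigenvalues i * overlap hA.1 hB.1 i j := by
      rw [hx, trace_re_eq hA.1, h1]
    have ep := trace_supportProj_mul hA.1 hB.1
    rw [← hpdef] at ep
    rw [trace_mul_cfc hA.1 hB.1, traceMulLog_eq_sum hA.1,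
      h1 fun i => hA.1.eigenvalues i * Real.log (hA.1.eigenvalues i)]
    generalize (p / x)⁻¹ = κ at key ⊢
    generalize Real.log (p / x) - 1 = c at key ⊢
    rw [ep, ex]
    simp only [Finset.sum_mul, ← Finset.sum_add_distrib, ← Finset.sum_sub_distrib, ← sub_mul]
    refine Finset.sum_le_sum fun i _ => Finset.sum_le_sum fun j _ => ?_
    have h := mul_le_mul_of_nonneg_right (key i j) (overlap_nonneg hA.1 hB.1 i j)
    linarith
  rw [Real.log_div hp.ne' hA'.ne'] at main
  have h2 : p * (p / x)⁻¹ = x := by field_simp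
  linarith

end supportProj

/-! ### Superadditivity and almost additivity of `Tr (A log A)` -/

section limits

open Filter Topology

variable {A B : Matrix n n ℂ}

theorem tendsto_traceMulLog_add_smul_one (hA : A.IsHermitian) :
    Tendsto (fun δ : ℝ => traceMulLog (A + δ • 1)) (𝓝[>] 0) (𝓝 (traceMulLog A)) := by
  have h : ∀ δ : ℝ, traceMulLog (A + δ • 1) =
      ∑ i, (hA.eigenvalues i + δ) * Real.log (hA.eigenvalues i + δ) := fun δ => by
    have hAδ : (A + δ • 1).IsHermitian :=
      hA.add (Matrix.isHermitian_one.smul (IsSelfAdjoint.all δ))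
    rw [traceMulLog, mul_cfc_self hAδ, cfc_add_smul_one hA, trace_cfc hA]
  simp only [h, traceMulLog_eq_sum hA]
  refine Tendsto.mono_left (tendsto_finsetSum _ fun i _ => ?_) nhdsWithin_le_nhds
  have hc : Continuous fun δ : ℝ =>
      (hA.eigenvalues i + δ) * Real.log (hA.eigenvalues i + δ) :=
    Real.continuous_mul_log.comp (continuous_const.add continuous_id)
  simpa using hc.tendsto 0

/-- Operator monotonicity of the logarithm, tested against the smaller matrix. -/
theorem traceMulLog_le_trace_mul_log (hA : A.PosSemidef) (hB : B.PosDef)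
    (hAB : (B - A).PosSemidef) : traceMulLog A ≤ (A * cfc Real.log B).trace.re := by
  -- Operator monotonicity needs a definite smaller matrix, so both are shifted by `δ`; on the left,
  -- `log (x + δ) ≥ log x` removes the shift again.
  have h : ∀ δ : ℝ, 0 < δ → traceMulLog A ≤ ∑ i, ∑ j, hA.1.eigenvalues i *
      Real.log (hB.1.eigenvalues j + δ) * overlap hA.1 hB.1 i j := by
    intro δ hδ
    rw [← trace_mul_cfc hA.1 hB.1 fun x => Real.log (x + δ), ← cfc_add_smul_one hB.1]
    have h1 := trace_mul_le_trace_mul hA (posSemidef_cfc_log_sub (posDef_add_smul_one hA hδ)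
      (B := B + δ • 1) (by simpa using hAB))
    refine le_trans ?_ h1
    rw [cfc_add_smul_one hA.1, mul_cfc_self hA.1, trace_cfc hA.1, traceMulLog_eq_sum hA.1]
    refine Finset.sum_le_sum fun i _ => ?_
    rcases (hA.eigenvalues_nonneg i).eq_or_lt with hi | hi
    · simp [← hi]
    · exact mul_le_mul_of_nonneg_left (Real.log_le_log hi (by linarith)) hi.le
  rw [trace_mul_cfc hA.1 hB.1]
  refine ge_of_tendsto (x := 𝓝[>] (0 : ℝ)) ?_ (eventually_nhdsWithin_of_forall h)
  refine Tendsto.mono_left (tendsto_finsetSum _ fun i _ => tendsto_finsetSum _ fun j _ => ?_)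
    nhdsWithin_le_nhds
  refine Tendsto.mul_const _ (Tendsto.const_mul _ ?_)
  have hj := (hB.eigenvalues_pos j).ne'
  have hc : ContinuousAt (fun δ : ℝ => Real.log (hB.1.eigenvalues j + δ)) 0 :=
    (continuousAt_const.add continuousAt_id).log (by simpa using hj)
  simpa [ContinuousAt] using hc

/-- Both `A` and `B` lie below `A + B`, so each is tested against `log (A + B)`; a shift by `δ`
makes the sum definite. -/
theorem traceMulLog_add_le (hA : A.PosSemidef) (hB : B.PosSemidef) :
    traceMulLog A + traceMulLog B ≤ traceMulLog (A + B) := by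
  have hT := hA.add hB
  have h : ∀ δ : ℝ, 0 < δ → traceMulLog A + traceMulLog B ≤
      ∑ i, hT.1.eigenvalues i * Real.log (hT.1.eigenvalues i + δ) := by
    intro δ hδ
    have hY := posDef_add_smul_one hT hδ
    have hδ1 : (δ • (1 : Matrix n n ℂ)).PosSemidef := Matrix.PosSemidef.one.smul hδ.le
    have h1 := traceMulLog_le_trace_mul_log hA hY (by
      rw [show A + B + δ • 1 - A = B + δ • (1 : Matrix n n ℂ) by abel]; exact hB.add hδ1)
    have h2 := traceMulLog_le_trace_mul_log hB hY (by
      rw [show A + B + δ • 1 - B = A + δ • (1 : Matrix n n ℂ) by abel]; exact hA.add hδ1)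
    rw [← trace_cfc hT.1 fun x => x * Real.log (x + δ), ← mul_cfc_self hT.1,
      ← cfc_add_smul_one hT.1, Matrix.add_mul, Matrix.trace_add, Complex.add_re]
    exact add_le_add h1 h2
  rw [traceMulLog_eq_sum hT.1]
  refine ge_of_tendsto (x := 𝓝[>] (0 : ℝ)) ?_ (eventually_nhdsWithin_of_forall h)
  refine Tendsto.mono_left (tendsto_finsetSum _ fun i _ => ?_) nhdsWithin_le_nhds
  rcases (hT.eigenvalues_nonneg i).eq_or_lt with hi | hi
  · simp [← hi]
  · refine Tendsto.const_mul _ ?_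
    have hc : ContinuousAt (fun δ : ℝ => Real.log (hT.1.eigenvalues i + δ)) 0 :=
      (continuousAt_const.add continuousAt_id).log (by simpa using hi.ne')
    simpa [ContinuousAt] using hc

/-- A comparison of increments on the unit interval by Riemann sums. -/
theorem sub_le_sub_of_increment_le {G H K : ℝ → ℝ}
    (hG : ∀ s t, 0 ≤ s → s ≤ t → t ≤ 1 → G t - G s ≤ (t - s) * K t)
    (hH : ∀ s t, 0 ≤ s → s ≤ t → t ≤ 1 → (t - s) * K s ≤ H t - H s) :
    G 1 - G 0 ≤ H 1 - H 0 := by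
  -- `K` is taken at right endpoints for `G` and at left endpoints for `H`, so the error telescopes
  -- and no regularity of `K` is needed.
  have h : ∀ N : ℕ, G 1 - G 0 ≤ H 1 - H 0 + (K 1 - K 0) * (1 / ((N : ℝ) + 1)) := by
    intro N
    have hN : (0 : ℝ) < (N : ℝ) + 1 := by positivity
    have step : ∀ k : ℕ, k ≤ N + 1 → G (k / ((N : ℝ) + 1)) - G 0 ≤ H (k / ((N : ℝ) + 1)) - H 0 +
        (K (k / ((N : ℝ) + 1)) - K 0) * (1 / ((N : ℝ) + 1)) := by
      intro k
      induction k with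
      | zero => intro _; simp
      | succ k ih =>
        intro hk
        have ih := ih (by omega)
        have hk' : ((k + 1 : ℕ) : ℝ) ≤ (N : ℝ) + 1 := by exact_mod_cast hk
        set s := (k : ℝ) / ((N : ℝ) + 1) with hs
        set t := ((k + 1 : ℕ) : ℝ) / ((N : ℝ) + 1) with ht
        have hts : t - s = 1 / ((N : ℝ) + 1) := by rw [hs, ht]; push_cast; ring
        have h0 : 0 ≤ s := by positivity
        have h1 : s ≤ t := by
          have : 0 < 1 / ((N : ℝ) + 1) := by positivity
          linarith
        have h2 : t ≤ 1 := (div_le_one hN).mpr hk'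
        have hG' := hG s t h0 h1 h2
        have hH' := hH s t h0 h1 h2
        rw [hts] at hG' hH'
        linarith
    have := step (N + 1) le_rfl
    rwa [show ((N + 1 : ℕ) : ℝ) / ((N : ℝ) + 1) = 1 by push_cast; exact div_self hN.ne'] at this
  refine ge_of_tendsto' (x := atTop) ?_ h
  simpa using (tendsto_one_div_add_atTop_nhds_zero_nat (𝕜 := ℝ)).const_mul (K 1 - K 0)
    |>.const_add (H 1 - H 0)

/-- Along `B + t A`, Klein's inequality bounds the increments of `Tr Y log Y` through `Tr A log (B +
t A)`, which `trace_mul_log_le` bounds by a function of the scalar `p + t e`. Here `K` is the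
derivative of the convex function `H`. -/
theorem traceMulLog_add_sub_le_of_posDef (hB : B.PosDef) (hA : A.PosSemidef)
    (hA' : 0 < A.trace.re) :
    traceMulLog (B + A) - traceMulLog B ≤ traceMulLog A - A.trace.re * Real.log A.trace.re +
      (((supportProj A * B).trace.re + A.trace.re) *
        Real.log ((supportProj A * B).trace.re + A.trace.re) -
      (supportProj A * B).trace.re * Real.log (supportProj A * B).trace.re) := by
  have hp := trace_supportProj_mul_pos hA hA' hB
  set p := (supportProj A * B).trace.re with hpdef
  set e := A.trace.re with he
  set c := traceMulLog A - e * Real.log e with hc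
  have hpos : ∀ t : ℝ, 0 ≤ t → (B + t • A).PosDef := fun t ht => hB.add_posSemidef (hA.smul ht)
  have h := sub_le_sub_of_increment_le (G := fun t => traceMulLog (B + t • A))
    (H := fun t => (p + t * e) * Real.log (p + t * e) + t * c)
    (K := fun t => e * (Real.log (p + t * e) + 1) + c) ?_ ?_
  · simp only [one_smul, zero_smul, add_zero, one_mul, zero_mul] at h
    linarith
  · intro s t hs hst ht
    have hY := hpos t (hs.trans hst)
    have h1 := trace_mul_log_sub_le (hpos s hs).posSemidef hY
    have h2 := trace_mul_log_le hA hA' hY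
    have h3 : (supportProj A * (B + t • A)).trace.re = p + t * e := by
      rw [Matrix.mul_add, Matrix.mul_smul, Matrix.trace_add, Matrix.trace_smul, Complex.add_re,
        Complex.smul_re, trace_supportProj_mul_self hA, smul_eq_mul]
    rw [h3] at h2
    have h4 : ((B + s • A) * cfc Real.log (B + t • A)).trace.re = traceMulLog (B + t • A) -
        (t - s) * (A * cfc Real.log (B + t • A)).trace.re := by
      rw [show B + s • A = (B + t • A) - (t - s) • A by rw [sub_smul]; abel, Matrix.sub_mul,
        Matrix.smul_mul, Matrix.trace_sub, Matrix.trace_smul, Complex.sub_re, Complex.smul_re,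
        smul_eq_mul, traceMulLog]
    have h5 : (B + t • A).trace.re - (B + s • A).trace.re = (t - s) * e := by
      simp only [Matrix.trace_add, Matrix.trace_smul, Complex.add_re, Complex.smul_re, smul_eq_mul]
      ring
    rw [h4, h5] at h1
    have h6 := mul_le_mul_of_nonneg_left h2 (sub_nonneg.mpr hst)
    linarith
  · intro s t hs hst ht
    have h1 := mul_log_sub_mul_log_le (x := p + t * e) (y := p + s * e)
      (by nlinarith) (by nlinarith)
    linarith

theorem traceMulLog_add_sub_le (hB : B.PosSemidef) (hA : A.PosSemidef) (hA' : 0 < A.trace.re) :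
    traceMulLog (B + A) - traceMulLog B ≤ traceMulLog A - A.trace.re * Real.log A.trace.re +
      (((supportProj A * B).trace.re + A.trace.re) *
        Real.log ((supportProj A * B).trace.re + A.trace.re) -
      (supportProj A * B).trace.re * Real.log (supportProj A * B).trace.re) := by
  set p := (supportProj A * B).trace.re with hpdef
  set r := (supportProj A).trace.re with hr
  set e := A.trace.re with he
  have h : ∀ δ : ℝ, 0 < δ → traceMulLog (B + A + δ • 1) - traceMulLog (B + δ • 1) ≤
      traceMulLog A - e * Real.log e + ((p + δ * r + e) * Real.log (p + δ * r + e) -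
        (p + δ * r) * Real.log (p + δ * r)) := by
    intro δ hδ
    have h1 := traceMulLog_add_sub_le_of_posDef (posDef_add_smul_one hB hδ) hA hA'
    rw [add_right_comm, Matrix.mul_add, Matrix.mul_smul, Matrix.mul_one, Matrix.trace_add,
      Matrix.trace_smul, Complex.add_re, Complex.smul_re, smul_eq_mul] at h1
    exact h1
  refine le_of_tendsto_of_tendsto ((tendsto_traceMulLog_add_smul_one (hB.add hA).1).sub
    (tendsto_traceMulLog_add_smul_one hB.1)) ?_ (eventually_nhdsWithin_of_forall h)
  refine Tendsto.mono_left (Tendsto.const_add _ ?_) nhdsWithin_le_nhds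
  have h1 : Continuous fun δ : ℝ => (p + δ * r + e) * Real.log (p + δ * r + e) -
      (p + δ * r) * Real.log (p + δ * r) :=
    (Real.continuous_mul_log.comp (by fun_prop : Continuous fun δ : ℝ => p + δ * r + e)).sub
      (Real.continuous_mul_log.comp (by fun_prop : Continuous fun δ : ℝ => p + δ * r))
  simpa using h1.tendsto 0

end limits

/-! ### Finiteness of the relative entropies -/

theorem relEntropy_of_posDef (ρ : Matrix n n ℂ) {σ : Matrix n n ℂ} (hσ : σ.PosDef) :
    relEntropy ρ σ = ((traceMulLog ρ - (ρ * cfc Real.log σ).trace.re : ℝ) : EReal) := by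
  have h : LinearMap.ker σ.mulVecLin ≤ LinearMap.ker ρ.mulVecLin := by
    rw [LinearMap.ker_eq_bot.mpr (Matrix.mulVec_injective_iff_isUnit.mpr hσ.isUnit)]
    exact bot_le
  rw [relEntropy, if_pos h, Matrix.trace_sub, Complex.sub_re, traceMulLog]

open scoped MatrixOrder Matrix.Norms.L2Operator in
theorem exists_exp_smul_sub_posSemidef {A B : Matrix n n ℂ} (hA : A.PosSemidef) (hB : B.PosDef) :
    ∃ l : ℝ, 0 < l ∧ (Real.exp l • B - A).PosSemidef := by
  cases isEmpty_or_nonempty n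
  · refine ⟨1, one_pos, ?_⟩
    rw [Subsingleton.elim (Real.exp 1 • B - A) 0]
    exact Matrix.PosSemidef.zero
  obtain ⟨r, hr, hrB⟩ := (CFC.exists_pos_algebraMap_le_iff hB.1.isSelfAdjoint).2
    fun x hx => hB.isStrictlyPositive.spectrum_pos hx
  have hAn := hA.1.isSelfAdjoint.le_algebraMap_norm_self
  have hrB' : (B - r • 1).PosSemidef := by
    rw [← Algebra.algebraMap_eq_smul_one]; exact Matrix.le_iff.mp hrB
  have hAn' : (‖A‖ • 1 - A).PosSemidef := by
    rw [← Algebra.algebraMap_eq_smul_one]; exact Matrix.le_iff.mp hAn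
  refine ⟨‖A‖ / r + 1, by positivity, ?_⟩
  set t := Real.exp (‖A‖ / r + 1) with ht
  have h1 : ‖A‖ ≤ t * r := by
    rw [← div_le_iff₀ hr, ht]
    linarith [Real.add_one_le_exp (‖A‖ / r + 1)]
  have h2 : t • B - A = t • (B - r • 1) + (t * r - ‖A‖) • (1 : Matrix n n ℂ) + (‖A‖ • 1 - A) := by
    rw [smul_sub, smul_smul, sub_smul]; abel
  rw [h2]
  exact ((hrB'.smul (Real.exp_pos _).le).add (Matrix.PosSemidef.one.smul (sub_nonneg.mpr h1))).add
    hAn'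

/-- The max-relative entropy with respect to a positive definite matrix is a real infimum. -/
theorem exists_maxRelEntropy_eq {ρ σ : Matrix n n ℂ} (hρ : ρ.PosSemidef) (hσ : σ.PosDef) :
    ∃ m : ℝ, maxRelEntropy ρ σ = m ∧
      IsGLB {l : ℝ | 0 < l ∧ (Real.exp l • σ - ρ).PosSemidef} m := by
  set S := {l : ℝ | 0 < l ∧ (Real.exp l • σ - ρ).PosSemidef} with hS
  have hne : S.Nonempty := exists_exp_smul_sub_posSemidef hρ hσ
  have hglb : IsGLB S (sInf S) := isGLB_csInf hne ⟨0, fun l hl => hl.1.le⟩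
  refine ⟨sInf S, le_antisymm ?_ ?_, hglb⟩
  · refine EReal.le_of_forall_lt_iff_le.mp fun z hz => ?_
    obtain ⟨l, hl, hlz⟩ := exists_lt_of_csInf_lt hne (EReal.coe_lt_coe_iff.mp hz)
    have h : maxRelEntropy ρ σ ≤ l := sInf_le ⟨l, hl.1, hl.2, rfl⟩
    exact h.trans (EReal.coe_le_coe_iff.mpr hlz.le)
  · refine le_sInf ?_
    rintro x ⟨l, hl, hl', rfl⟩
    exact EReal.coe_le_coe_iff.mpr (hglb.1 ⟨hl, hl'⟩)

/-! ### The Jordan-Hahn decomposition -/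

/-- Orthogonality kills the cross terms, so `Δᴴ Δ = (P + N)²` and the modulus of `Δ` is `P + N`. -/
theorem traceNorm_of_isJordanHahn {Δ P N : Matrix n n ℂ} (h : IsJordanHahn Δ P N) :
    traceNorm Δ = P.trace.re + N.trace.re := by
  have hS := h.pos.add h.neg
  have hNP : N * P = 0 := by
    have := congrArg Matrix.conjTranspose h.orthogonal
    rwa [Matrix.conjTranspose_mul, h.pos.1.eq, h.neg.1.eq, Matrix.conjTranspose_zero] at this
  have h1 : Δᴴ * Δ = cfc (fun x : ℝ => x * x) (P + N) := by
    rw [← mul_cfc_self hS.1 fun x => x, cfc_id' ℝ _ hS.1.isSelfAdjoint, h.eq_sub,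
      Matrix.conjTranspose_sub, h.pos.1.eq, h.neg.1.eq]
    simp only [Matrix.mul_sub, Matrix.sub_mul, Matrix.mul_add, Matrix.add_mul, h.orthogonal, hNP]
    abel
  rw [traceNorm, h1, ← cfc_comp' Real.sqrt (fun x => x * x) (P + N)
    (((P + N).finite_real_spectrum.image _).continuousOn _)
    ((P + N).finite_real_spectrum.continuousOn _) hS.1.isSelfAdjoint, trace_cfc hS.1,
    ← Complex.add_re, ← Matrix.trace_add, trace_re_eq hS.1]
  exact Finset.sum_congr rfl fun i _ => Real.sqrt_mul_self (hS.eigenvalues_nonneg i)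

/-! ### Scaling of the logarithm and a scalar entropy inequality -/

open scoped MatrixOrder Matrix.Norms.L2Operator in
theorem cfc_log_smul {A : Matrix n n ℂ} (hA : A.PosDef) {c : ℝ} (hc : 0 < c) :
    cfc Real.log (c • A) = Real.log c • 1 + cfc Real.log A := by
  rw [← Algebra.algebraMap_eq_smul_one]
  exact CFC.log_smul' A hc hA.isStrictlyPositive

/-- Both `a + e` and `1 - e` are convex combinations of `a` and `1`, with exchanged weights. Adding
the two convexity inequalities for `x log x` bounds the sum of its values there by `a log a`. -/
theorem mul_log_add_sub_le_binEntropy {a e : ℝ} (ha : 0 ≤ a) (he : 0 < e) (hae : a + e ≤ 1) :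
    (a + e) * Real.log (a + e) - a * Real.log a - e * Real.log e ≤ Real.binEntropy e := by
  have hL : 0 < 1 - a := by linarith
  have hconv := Real.convexOn_mul_log.2
  have h1 := hconv (x := a) (y := 1) ha (by norm_num : (1:ℝ) ∈ Set.Ici 0)
    (a := (1 - a - e) / (1 - a)) (b := e / (1 - a)) (by apply div_nonneg <;> linarith)
    (by positivity) (by field_simp; ring)
  have h2 := hconv (x := a) (y := 1) ha (by norm_num : (1:ℝ) ∈ Set.Ici 0)
    (a := e / (1 - a)) (b := (1 - a - e) / (1 - a)) (by positivity)
    (by apply div_nonneg <;> linarith) (by field_simp; ring)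
  simp only [smul_eq_mul, Real.log_one, mul_zero, add_zero, mul_one] at h1 h2
  rw [show (1 - a - e) / (1 - a) * a + e / (1 - a) = a + e by field_simp; ring] at h1
  rw [show e / (1 - a) * a + (1 - a - e) / (1 - a) = 1 - e by field_simp; ring] at h2
  have h3 : (1 - a - e) / (1 - a) * (a * Real.log a) + e / (1 - a) * (a * Real.log a) =
      a * Real.log a := by field_simp; ring
  rw [Real.binEntropy, Real.log_inv, Real.log_inv]
  linarith

/-! ### The continuity bound -/

section bound

variable {ρ₁ ρ₂ σ P N : Matrix n n ℂ}

/-- The traces of the parts of the Jordan-Hahn decomposition of a difference of states. -/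
theorem trace_of_isJordanHahn (h₁ : IsState ρ₁) (h₂ : IsState ρ₂)
    (h : IsJordanHahn (ρ₁ - ρ₂) P N) :
    P.trace.re = traceDist ρ₁ ρ₂ ∧ N.trace.re = traceDist ρ₁ ρ₂ := by
  have h1 := congrArg (fun M => (Matrix.trace M).re) h.eq_sub
  simp only [Matrix.trace_sub, Complex.sub_re, h₁.trace_eq_one, h₂.trace_eq_one] at h1
  rw [traceDist, traceNorm_of_isJordanHahn h]
  constructor <;> linarith

/-- A sharp upper bound on the difference of the entropies of two states in terms of their
Jordan-Hahn decomposition. -/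
theorem traceMulLog_sub_le (h₁ : IsState ρ₁) (h₂ : IsState ρ₂)
    (h : IsJordanHahn (ρ₁ - ρ₂) P N) (hε : 0 < traceDist ρ₁ ρ₂) :
    traceMulLog ρ₁ - traceMulLog ρ₂ ≤
      traceMulLog P - traceMulLog N + Real.binEntropy (traceDist ρ₁ ρ₂) := by
  obtain ⟨hP, -⟩ := trace_of_isJordanHahn h₁ h₂ h
  set ε := traceDist ρ₁ ρ₂
  have hT : ρ₁ + N = ρ₂ + P := by
    have := h.eq_sub
    rw [sub_eq_iff_eq_add] at this
    rw [this]; abel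
  have h3 := traceMulLog_add_le h₁.posSemidef h.neg
  have h4 := traceMulLog_add_sub_le h₂.posSemidef h.pos (hP ▸ hε)
  rw [hP] at h4
  have hPN : (supportProj P * N).trace.re = 0 :=
    trace_supportProj_mul_eq_zero h.pos h.neg (by rw [h.orthogonal]; simp)
  -- As `N` is orthogonal to the support of `P`, the left side is the weight of `ρ₁` on that
  -- support.
  have h5 : (supportProj P * ρ₂).trace.re + ε ≤ 1 := by
    have h6 : (supportProj P * (ρ₁ + N)).trace.re = (supportProj P * (ρ₂ + P)).trace.re := by
      rw [hT]
    simp only [Matrix.mul_add, Matrix.trace_add, Complex.add_re, hPN,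
      trace_supportProj_mul_self h.pos, hP] at h6
    have h7 := trace_mul_nonneg (posSemidef_one_sub_supportProj_add h.pos h.neg
      (by rw [h.orthogonal]; simp)) h₁.posSemidef
    have h8 := trace_mul_nonneg (posSemidef_supportProj N) h₁.posSemidef
    rw [Matrix.sub_mul, Matrix.add_mul, Matrix.one_mul, Matrix.trace_sub, Matrix.trace_add,
      Complex.sub_re, Complex.add_re, h₁.trace_eq_one, Complex.one_re] at h7
    linarith
  have h9 := mul_log_add_sub_le_binEntropy
    (trace_mul_nonneg (posSemidef_supportProj P) h₂.posSemidef) hε h5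
  rw [hT] at h3
  linarith

/-- The one-sided continuity bound, with the max-relative entropy of the positive part. -/
theorem one_lt_exp_and_relEntropy_sub_le {ε m : ℝ} {ρp ρm : Matrix n n ℂ} (h₁ : IsState ρ₁)
    (h₂ : IsState ρ₂) (hσ : IsState σ) (hσ' : σ.PosDef) (hε : 0 < ε)
    (hd : traceDist ρ₁ ρ₂ = ε) (h : IsJordanHahn (ρ₁ - ρ₂) (ε • ρp) (ε • ρm))
    (hm : IsGLB {l : ℝ | 0 < l ∧ (Real.exp l • σ - ρp).PosSemidef} m) :
    1 < Real.exp m ∧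
      (relEntropy ρ₁ σ).toReal - (relEntropy ρ₂ σ).toReal ≤
        ε * Real.log (Real.exp m - 1) + Real.binEntropy ε := by
  obtain ⟨hP, hN⟩ := trace_of_isJordanHahn h₁ h₂ h
  have hent := traceMulLog_sub_le h₁ h₂ h (hd ▸ hε)
  rw [hd] at hP hN hent
  set P := ε • ρp with hPdef
  set N := ε • ρm with hNdef
  have hs := trace_supportProj_mul_pos h.neg (hN ▸ hε) hσ'
  have hcross := trace_mul_log_le h.neg (hN ▸ hε) hσ'
  rw [hN] at hcross
  set s := (supportProj N * σ).trace.re with hsdef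
  have hsum : (supportProj P * σ).trace.re + s ≤ 1 := by
    have h7 := trace_mul_nonneg (posSemidef_one_sub_supportProj_add h.pos h.neg
      (by rw [h.orthogonal]; simp)) hσ.posSemidef
    rw [Matrix.sub_mul, Matrix.add_mul, Matrix.one_mul, Matrix.trace_sub, Matrix.trace_add,
      Complex.sub_re, Complex.add_re, hσ.trace_eq_one, Complex.one_re] at h7
    linarith
  have hl : ∀ l : ℝ, (Real.exp l • σ - ρp).PosSemidef → ((ε * Real.exp l) • σ - P).PosSemidef := by
    intro l hl
    rw [hPdef, mul_smul, ← smul_sub]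
    exact hl.smul hε.le
  -- Testing `P ≤ ε e^l σ` on the support of `P` gives `σ` weight at least `e^{-l}` there, leaving
  -- at most `1 - e^{-l}` for `s`.
  have hmass : ∀ l : ℝ, (Real.exp l • σ - ρp).PosSemidef → -Real.log (1 - s) ≤ l := by
    intro l hl'
    have h1 := trace_mul_le_trace_mul (posSemidef_supportProj P) (hl l hl')
    rw [trace_supportProj_mul_self h.pos, hP, Matrix.mul_smul, Matrix.trace_smul, Complex.smul_re,
      smul_eq_mul, mul_assoc] at h1
    have h2 : 1 ≤ Real.exp l * (supportProj P * σ).trace.re := by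
      nlinarith
    have h3 : Real.exp (-l) ≤ 1 - s := by
      rw [Real.exp_neg, inv_eq_one_div, div_le_iff₀' (Real.exp_pos l)]
      nlinarith [Real.exp_pos l]
    have := Real.log_le_log (Real.exp_pos _) h3
    rw [Real.log_exp] at this
    linarith
  have hbound : ∀ l : ℝ, (Real.exp l • σ - ρp).PosSemidef →
      (traceMulLog P - ε * Real.log ε - (P * cfc Real.log σ).trace.re) / ε ≤ l := by
    intro l hl'
    have hc : 0 < ε * Real.exp l := mul_pos hε (Real.exp_pos l)
    have h1 := traceMulLog_le_trace_mul_log h.pos (hσ'.smul hc) (hl l hl')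
    rw [cfc_log_smul hσ' hc, Matrix.mul_add, Matrix.mul_smul, Matrix.mul_one, Matrix.trace_add,
      Matrix.trace_smul, Complex.add_re, Complex.smul_re, smul_eq_mul, hP,
      Real.log_mul hε.ne' (Real.exp_pos l).ne', Real.log_exp] at h1
    rw [div_le_iff₀ hε]
    linarith
  obtain ⟨l₀, hl₀, hl₀'⟩ := hm.nonempty
  have hs1 : s < 1 := by
    have h1 := trace_mul_le_trace_mul (posSemidef_supportProj P) (hl l₀ hl₀')
    rw [trace_supportProj_mul_self h.pos, hP, Matrix.mul_smul, Matrix.trace_smul, Complex.smul_re,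
      smul_eq_mul] at h1
    have h2 : 0 < (supportProj P * σ).trace.re :=
      pos_of_mul_pos_right (hε.trans_le h1) (by positivity)
    linarith
  -- Lower bounds valid for every admissible `l` pass to the infimum, so attainment is not needed.
  have hm1 : -Real.log (1 - s) ≤ m := hm.2 fun l hl => hmass l hl.2
  have hm2 := hm.2 (a := _) fun l hl => hbound l hl.2
  have hexp : (1 - s)⁻¹ ≤ Real.exp m := by
    rw [← Real.exp_log (inv_pos.mpr (sub_pos.mpr hs1)), Real.log_inv]
    exact Real.exp_le_exp.mpr hm1
  have h1m : 1 < Real.exp m := lt_of_lt_of_le ((one_lt_inv₀ (by linarith)).mpr (by linarith)) hexp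
  refine ⟨h1m, ?_⟩
  have hlog : m + Real.log s ≤ Real.log (Real.exp m - 1) := by
    rw [← Real.log_exp m, ← Real.log_mul (Real.exp_pos _).ne' hs.ne', Real.log_exp]
    refine Real.log_le_log (mul_pos (Real.exp_pos m) hs) ?_
    rw [inv_le_iff_one_le_mul₀ (by linarith)] at hexp
    linarith
  rw [div_le_iff₀ hε] at hm2
  have hdiff : (ρ₁ * cfc Real.log σ).trace.re - (ρ₂ * cfc Real.log σ).trace.re =
      (P * cfc Real.log σ).trace.re - (N * cfc Real.log σ).trace.re := by
    rw [← Complex.sub_re, ← Complex.sub_re, ← Matrix.trace_sub, ← Matrix.trace_sub,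
      ← Matrix.sub_mul, ← Matrix.sub_mul, h.eq_sub]
  rw [relEntropy_of_posDef ρ₁ hσ', relEntropy_of_posDef ρ₂ hσ', EReal.toReal_coe, EReal.toReal_coe]
  have := mul_le_mul_of_nonneg_left hlog hε.le
  linarith

theorem IsJordanHahn.swap {m : Type*} [Fintype m] {Δ P N : Matrix m m ℂ} (h : IsJordanHahn Δ P N) :
    IsJordanHahn (-Δ) N P where
  pos := h.neg
  neg := h.pos
  orthogonal := by
    have := congrArg Matrix.conjTranspose h.orthogonal
    rwa [Matrix.conjTranspose_mul, h.pos.1.eq, h.neg.1.eq, Matrix.conjTranspose_zero] at this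
  eq_sub := by rw [h.eq_sub, neg_sub]

theorem traceDist_comm (A B : Matrix n n ℂ) : traceDist A B = traceDist B A := by
  rw [traceDist, traceDist, traceNorm, traceNorm, ← neg_sub B A, Matrix.conjTranspose_neg,
    neg_mul_neg]

theorem relEntropy_self (hσ : σ.PosDef) : (relEntropy σ σ).toReal = 0 := by
  rw [relEntropy_of_posDef σ hσ, traceMulLog, sub_self, EReal.toReal_coe]

theorem relEntropy_ne_top (ρ : Matrix n n ℂ) (hσ : σ.PosDef) : relEntropy ρ σ ≠ ⊤ := by
  rw [relEntropy_of_posDef ρ hσ]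
  exact EReal.coe_ne_top _

theorem posSemidef_of_smul {m : Type*} {A : Matrix m m ℂ} {c : ℝ} (hc : 0 < c)
    (h : (c • A).PosSemidef) : A.PosSemidef := by
  have := h.smul (inv_pos.mpr hc).le
  rwa [smul_smul, inv_mul_cancel₀ hc.ne', one_smul] at this

end bound

end QuantumEntropy

theorem theorem3 {n : Type*} [Fintype n] [DecidableEq n] :
    (∀ (ε : ℝ) (ρ₁ ρ₂ σ ρp ρm : Matrix n n ℂ),
      0 < ε → ε < 1 →
      QuantumEntropy.IsState ρ₁ → QuantumEntropy.IsState ρ₂ →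
      QuantumEntropy.IsState σ → σ.PosDef →
      QuantumEntropy.traceDist ρ₁ ρ₂ = ε →
      QuantumEntropy.IsJordanHahn (ρ₁ - ρ₂) (ε • ρp) (ε • ρm) →
      QuantumEntropy.relEntropy ρ₁ σ ≠ ⊤ ∧ QuantumEntropy.relEntropy ρ₂ σ ≠ ⊤ ∧
      QuantumEntropy.maxRelEntropy ρp σ ≠ ⊤ ∧ QuantumEntropy.maxRelEntropy ρm σ ≠ ⊤ ∧
      1 < Real.exp (max (QuantumEntropy.maxRelEntropy ρp σ)
            (QuantumEntropy.maxRelEntropy ρm σ)).toReal ∧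
      |(QuantumEntropy.relEntropy ρ₁ σ).toReal - (QuantumEntropy.relEntropy ρ₂ σ).toReal| ≤
        ε * Real.log (Real.exp (max (QuantumEntropy.maxRelEntropy ρp σ)
            (QuantumEntropy.maxRelEntropy ρm σ)).toReal - 1) + Real.binEntropy ε) ∧
    (∀ (ε : ℝ) (ρ σ ωp ωm : Matrix n n ℂ),
      0 < ε → ε < 1 →
      QuantumEntropy.IsState ρ → QuantumEntropy.IsState σ → σ.PosDef →
      QuantumEntropy.traceDist ρ σ = ε →
      QuantumEntropy.IsJordanHahn (ρ - σ) (ε • ωp) (ε • ωm) →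
      QuantumEntropy.relEntropy ρ σ ≠ ⊤ ∧
      QuantumEntropy.maxRelEntropy ωp σ ≠ ⊤ ∧
      1 < Real.exp (QuantumEntropy.maxRelEntropy ωp σ).toReal ∧
      (QuantumEntropy.relEntropy ρ σ).toReal ≤
        ε * Real.log (Real.exp (QuantumEntropy.maxRelEntropy ωp σ).toReal - 1)
          + Real.binEntropy ε) := by
  refine ⟨?_, ?_⟩
  · intro ε ρ₁ ρ₂ σ ρp ρm hε _ h₁ h₂ hσ hσ' hd h
    have hp := QuantumEntropy.posSemidef_of_smul hε h.pos
    have hn := QuantumEntropy.posSemidef_of_smul hε h.neg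
    obtain ⟨mp, hmp, hmp'⟩ := QuantumEntropy.exists_maxRelEntropy_eq hp hσ'
    obtain ⟨mm, hmm, hmm'⟩ := QuantumEntropy.exists_maxRelEntropy_eq hn hσ'
    obtain ⟨h3, h4⟩ :=
      QuantumEntropy.one_lt_exp_and_relEntropy_sub_le h₁ h₂ hσ hσ' hε hd h hmp'
    have h' := h.swap
    rw [neg_sub] at h'
    obtain ⟨h5, h6⟩ := QuantumEntropy.one_lt_exp_and_relEntropy_sub_le h₂ h₁ hσ hσ' hε
      ((QuantumEntropy.traceDist_comm ρ₂ ρ₁).trans hd) h' hmm'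
    have hmax : (max (QuantumEntropy.maxRelEntropy ρp σ)
        (QuantumEntropy.maxRelEntropy ρm σ)).toReal = max mp mm := by
      rw [hmp, hmm, ← EReal.coe_strictMono.monotone.map_max, EReal.toReal_coe]
    -- The condition `1 < e^x` keeps the argument of the logarithm positive, where it is monotone.
    have hmono : ∀ x : ℝ, 1 < Real.exp x → x ≤ max mp mm →
        ε * Real.log (Real.exp x - 1) ≤ ε * Real.log (Real.exp (max mp mm) - 1) := by
      intro x hx hxm
      refine mul_le_mul_of_nonneg_left (Real.log_le_log (by linarith) ?_) hε.le
      linarith [Real.exp_le_exp.mpr hxm]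
    refine ⟨QuantumEntropy.relEntropy_ne_top ρ₁ hσ', QuantumEntropy.relEntropy_ne_top ρ₂ hσ',
      hmp ▸ EReal.coe_ne_top mp, hmm ▸ EReal.coe_ne_top mm, ?_, ?_⟩
    · rw [hmax]
      exact h3.trans_le (Real.exp_le_exp.mpr (le_max_left _ _))
    · rw [hmax, abs_le]
      have h7 := hmono mp h3 (le_max_left _ _)
      have h8 := hmono mm h5 (le_max_right _ _)
      constructor <;> linarith
  · intro ε ρ σ ωp ωm hε _ hρ hσ hσ' hd h
    have hp := QuantumEntropy.posSemidef_of_smul hε h.pos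
    obtain ⟨m, hm, hm'⟩ := QuantumEntropy.exists_maxRelEntropy_eq hp hσ'
    obtain ⟨h3, h4⟩ :=
      QuantumEntropy.one_lt_exp_and_relEntropy_sub_le hρ hσ hσ hσ' hε hd h hm'
    rw [QuantumEntropy.relEntropy_self hσ', sub_zero] at h4
    refine ⟨QuantumEntropy.relEntropy_ne_top ρ hσ', hm ▸ EReal.coe_ne_top m, ?_, ?_⟩
    · rwa [hm, EReal.toReal_coe]
    · rwa [hm, EReal.toReal_coe]
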